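/- Let $X\subset\mathbb R^2$ be a polygonal free space: a compact set that is the closure of its interior and whose boundary is a finite union of pairwise disjoint simple closed polygons. Let a convex division of $X$ be given: finitely many convex polygons (the cells; closed, with non-empty interior), with pairwise disjoint interiors and with union $X$, each of which is the convex hull of a set of vertices of the boundary polygons of $X$. Two distinct cells are called adjacent if their intersection is a non-degenerate segment (a cutline). Say that a path (continuous map) $f:[0,1]\to X$ runs through a finite sequence of cells $(s_1,\dots,s_n)$, $n\ge 1$, if successive cells of the sequence are adjacent and there are times $0=t_0\le t_1\le\dots\le t_n=1$ with $f([t_{k-1},t_k])\subset s_k$ for $k=1,\dots,n$. A cell sequence $\Gamma\circ f$ of $f$ is a finite sequence through which $f$ runs and which has no superfluous members, that is, $f$ runs through no proper subsequence of it. (When $f$ stays on a cutline there may be several cell sequences, and any of them may be taken as $\Gamma\circ f$.) Let $S(f)\in[0,\infty]$ be the length of $f$, the supremum of $\sum_i\|f(\tau_{i+1})-f(\tau_i)\|$ over all finite partitions $\tau_0\le\tau_1\le\cdots\le\tau_m$ in $[0,1]$. If a cell sequence $\Gamma\circ f$ of a path $f$ in $X$ contains some cell more than once, then $f$ is not a globally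 shortest path between its endpoints: there is a path $g$ in $X$ with $g(0)=f(0)$, $g(1)=f(1)$ and $S(g)<S(f)$. -/

import Mathlib

/-- The Euclidean plane `ℝ²`. -/
abbrev Plane : Type := EuclideanSpace ℝ (Fin 2)

/-- The free space: a compact set `carrier` in the plane which is the closure of its interior and
whose boundary consists of finitely many pairwise disjoint simple closed polygons (outer boundaries
of the components and boundaries of the obstacles). -/
structure FreeSpace where
  carrier : Set Plane
  /-- the number of boundary loops -/
  numLoops : ℕ
  /-- the number of vertices of each boundary loop -/
  size : Fin numLoops → ℕ
  /-- the boundary loops, as closed polygons -/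
  loop : (k : Fin numLoops) → Polygon Plane (size k)
  three_le_size : ∀ k, 3 ≤ size k
  /-- The half-open edges `[vᵢ, vᵢ₊₁)` of all the loops are pairwise disjoint: no loop meets itself
  (except for closing up), and distinct loops are disjoint. -/
  simple_disjoint : Pairwise fun e e' : (k : Fin numLoops) × Fin (size k) =>
    Disjoint ((loop e.1).edgePath ℝ e.2 '' Set.Ico (0 : ℝ) 1)
      ((loop e'.1).edgePath ℝ e'.2 '' Set.Ico (0 : ℝ) 1)
  isCompact_carrier : IsCompact carrier
  closure_interior_carrier : closure (interior carrier) = carrier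
  frontier_carrier : frontier carrier = ⋃ k, (loop k).boundary ℝ

namespace FreeSpace

/-- The vertices of the boundary polygons of the free space. -/
def vertexSet (X : FreeSpace) : Set Plane := ⋃ k, Set.range (X.loop k).vertices

/-- A convex division of the free space: finitely many convex polygons (closed, with nonempty
interior) with pairwise disjoint interiors and with union the free space, such that no new vertices
are created, i.e. each of the polygons is spanned by vertices of the boundary of the free space. -/
structure ConvexDivision (X : FreeSpace) where
  cells : Set (Set Plane)
  finite_cells : cells.Finite
  exists_vertices : ∀ P ∈ cells, ∃ S ⊆ X.vertexSet, P = convexHull ℝ S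
  nonempty_interior : ∀ P ∈ cells, (interior P).Nonempty
  disjoint_interior : cells.Pairwise fun P Q => Disjoint (interior P) (interior Q)
  sUnion_cells : ⋃₀ cells = X.carrier

/-- The length of a path in the free space: the supremum of the sums `∑ ‖f(tᵢ₊₁) - f(tᵢ)‖` over
all `t₀ ≤ t₁ ≤ … ≤ tₙ` in `[0, 1]` (possibly `∞`). -/
noncomputable def length (X : FreeSpace) {x₀ x₁ : X.carrier} (f : Path x₀ x₁) : ENNReal :=
  eVariationOn (fun t : unitInterval => (f t : Plane)) Set.univ

/-- `f` is a globally shortest path: no path in the free space with the same endpoints (homotopic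
to `f` or not) is shorter. -/
def IsGloballyShortest (X : FreeSpace) {x₀ x₁ : X.carrier} (f : Path x₀ x₁) : Prop :=
  ∀ g : Path x₀ x₁, X.length f ≤ X.length g

namespace ConvexDivision

variable {X : FreeSpace}

/-- The topological graph: its nodes are the polygons of the division, and two of them are adjacent
if they have a cutline, that is, a nondegenerate segment, in common. -/
def topoGraph (D : ConvexDivision X) : SimpleGraph D.cells where
  Adj P Q := P ≠ Q ∧ ∃ a b : Plane, a ≠ b ∧ (P : Set Plane) ∩ Q = segment ℝ a b
  symm := ⟨by
    rintro P Q ⟨hPQ, a, b, hab, h⟩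
    exact ⟨hPQ.symm, a, b, hab, by rw [Set.inter_comm, h]⟩⟩
  loopless := ⟨fun _ h => h.1 rfl⟩

/-- Paths in the topological graph: nonempty finite sequences of successively adjacent nodes. -/
def IsTopoPath (D : ConvexDivision X) (s : List D.cells) : Prop :=
  s ≠ [] ∧ s.IsChain D.topoGraph.Adj

/-- `f` runs through the polygons of the path `s = (s₀, …, sₙ₋₁)` of the topological graph one
after the other: there are times `0 = t₀ ≤ t₁ ≤ … ≤ tₙ = 1` such that `f` stays in `sₖ` on
`[tₖ, tₖ₊₁]` (so it changes from `sₖ` to `sₖ₊₁` on their common cutline, at time `tₖ₊₁`). -/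
def RunsThrough (D : ConvexDivision X) {x₀ x₁ : X.carrier} (f : Path x₀ x₁)
    (s : List D.cells) : Prop :=
  D.IsTopoPath s ∧ ∃ t : ℕ → unitInterval, Monotone t ∧ t 0 = 0 ∧ t s.length = 1 ∧
    ∀ (k : ℕ) (hk : k < s.length), ∀ τ ∈ Set.Icc (t k) (t (k + 1)), (f τ : Plane) ∈ (s[k] : Set Plane)

/-- `s` is the cell sequence of `f`, the sequence of the polygons passed by `f` in their order:
`f` runs through `s`, and `s` has no superfluous members, i.e. `f` does not run through any proper
subsequence of `s`. So a polygon next to the current one, whose boundary is touched without a need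
to enter it, is not listed. While `f` stays on a cutline there may be a choice between the polygons
on its two sides; the definition admits all of them. -/
def IsCellSequence (D : ConvexDivision X) {x₀ x₁ : X.carrier} (f : Path x₀ x₁)
    (s : List D.cells) : Prop :=
  D.RunsThrough f s ∧ ∀ s' : List D.cells, s'.Sublist s → D.RunsThrough f s' → s' = s

end ConvexDivision

end FreeSpace

namespace FreeSpace

/-! Suppose `f` is globally shortest and a cell `P` occurs at positions `i < j`. As `P` is convex
and lies in the free space, replacing `f` by a segment between its two visits to `P` gives a
competitor. Minimality forces equality in the triangle inequality, so `f` already runs along that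
segment and stays in `P` (`mem_of_convex`). The cells at positions `i + 1, …, j` are then
superfluous (`take_append_drop`), contradicting the definition of a cell sequence. Comparing lengths
means cancelling the unchanged pieces, which requires `f` to have finite length. Straightening `f`
inside each of the finitely many convex cells gives a competitor of finite length
(`exists_length_ne_top`), so a shortest path has finite length too. -/

/-- The variation of an affine segment traversed monotonically is at most the distance of its
endpoints. -/
theorem eVariationOn_lineMap_comp_le (p q : Plane) {a b : unitInterval} (hab : a ≤ b)
    {θ : unitInterval → ℝ} (hθ : MonotoneOn θ (Set.Icc a b)) (h0 : 0 ≤ θ a) (h1 : θ b ≤ 1) :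
    eVariationOn (fun t => AffineMap.lineMap p q (θ t)) (Set.Icc a b) ≤ edist p q := by
  have hL : LipschitzOnWith (nndist p q) (AffineMap.lineMap p q : ℝ → Plane) Set.univ :=
    (lipschitzWith_lineMap p q).lipschitzOnWith
  have h2 := hL.comp_eVariationOn_le (g := θ) (s := Set.Icc a b) (fun _ _ => Set.mem_univ _)
  have h3 := hθ.eVariationOn_eq (Set.left_mem_Icc.2 hab) (Set.right_mem_Icc.2 hab)
  rw [Set.inter_self] at h3
  have h4 : ENNReal.ofReal (θ b - θ a) ≤ 1 := by
    rw [← ENNReal.ofReal_one]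
    exact ENNReal.ofReal_le_ofReal (by linarith)
  calc _ ≤ (nndist p q : ENNReal) * eVariationOn θ (Set.Icc a b) := h2
    _ ≤ (nndist p q : ENNReal) * 1 := by gcongr; exact h3.trans_le h4
    _ = edist p q := by rw [mul_one, edist_nndist]

/-- A path can be straightened between two times at which it lies in a convex subset of the free
space. -/
theorem exists_path_straightened (X : FreeSpace) {x₀ x₁ : X.carrier} (f : Path x₀ x₁)
    {C : Set Plane} (hC : Convex ℝ C) (hCX : C ⊆ X.carrier) {a b : unitInterval} (hab : a ≤ b)
    (ha : (f a : Plane) ∈ C) (hb : (f b : Plane) ∈ C) :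
    ∃ g : Path x₀ x₁, (∀ t ≤ a, g t = f t) ∧ (∀ t, b ≤ t → g t = f t) ∧
      eVariationOn (fun t => (g t : Plane)) (Set.Icc a b) ≤ edist (f a : Plane) (f b) := by
  rcases hab.eq_or_lt with rfl | hlt
  · exact ⟨f, fun _ _ => rfl, fun _ _ => rfl, by simp⟩
  have hlt' : (a : ℝ) < b := hlt
  have hpos : 0 < (b : ℝ) - a := sub_pos.2 hlt'
  -- Time rescaled from `[a, b]` to `[0, 1]` and clamped to 0 before `a` and 1 after `b`.
  let θ : unitInterval → ℝ := fun t => (max (a : ℝ) (min b t) - a) / (b - a)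
  have hθle : ∀ t ≤ a, θ t = 0 := fun t ht => by
    have : (t : ℝ) ≤ a := ht
    simp only [θ]
    rw [max_eq_left ((min_le_right _ _).trans this), sub_self, zero_div]
  have hθge : ∀ t, b ≤ t → θ t = 1 := fun t ht => by
    have : (b : ℝ) ≤ t := ht
    simp only [θ]
    rw [min_eq_left this, max_eq_right hlt'.le, div_self hpos.ne']
  have hmono : Monotone θ := fun s t hst => by
    have : (s : ℝ) ≤ t := hst
    simp only [θ]
    gcongr
  have hθcont : Continuous θ := by fun_prop
  -- Each summand varies on only one of `[0, a]`, `[a, b]`, `[b, 1]`, so the concatenation is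
  -- continuous without a gluing argument.
  let F : unitInterval → Plane := fun t =>
    (f (min t a) : Plane) + (AffineMap.lineMap (f a : Plane) (f b) (θ t) - (f a : Plane)) +
      ((f (max t b) : Plane) - f b)
  have hFle : ∀ t ≤ a, F t = f t := fun t ht => by
    simp [F, hθle t ht, min_eq_left ht, max_eq_right (ht.trans hab)]
  have hFge : ∀ t, b ≤ t → F t = f t := fun t ht => by
    simp [F, hθge t ht, min_eq_right (hab.trans ht), max_eq_left ht]
  have hFmid : ∀ t ∈ Set.Icc a b, F t = AffineMap.lineMap (f a : Plane) (f b) (θ t) :=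
    fun t ht => by simp [F, min_eq_right ht.1, max_eq_right ht.2]
  have hFcont : Continuous F := by
    have hline : Continuous (AffineMap.lineMap (f a : Plane) (f b : Plane) : ℝ → Plane) :=
      (lipschitzWith_lineMap _ _).continuous
    have := hline.comp hθcont
    simp only [Function.comp_def] at this
    fun_prop
  have hFmem : ∀ t, F t ∈ X.carrier := fun t => by
    rcases le_total t a with h | h
    · rw [hFle t h]; exact (f t).2
    rcases le_total b t with h' | h'
    · rw [hFge t h']; exact (f t).2
    rw [hFmid t ⟨h, h'⟩]
    refine hCX (hC.lineMap_mem ha hb ⟨?_, ?_⟩)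
    · rw [← hθle a le_rfl]; exact hmono h
    · rw [← hθge b le_rfl]; exact hmono h'
  refine ⟨⟨⟨fun t => ⟨F t, hFmem t⟩, by fun_prop⟩, ?_, ?_⟩, fun t ht => Subtype.ext (hFle t ht),
    fun t ht => Subtype.ext (hFge t ht), ?_⟩
  · exact Subtype.ext ((hFle 0 unitInterval.nonneg').trans (by rw [f.source]))
  · exact Subtype.ext ((hFge 1 unitInterval.le_one').trans (by rw [f.target]))
  · refine (eVariationOn.eq_of_eqOn (f' := fun t => AffineMap.lineMap (f a : Plane) (f b) (θ t))
      hFmid).le.trans ?_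
    exact eVariationOn_lineMap_comp_le _ _ hab (hmono.monotoneOn _) (hθle a le_rfl).ge
      (hθge b le_rfl).le

theorem length_eq_add (X : FreeSpace) {x₀ x₁ : X.carrier} (f : Path x₀ x₁) {a b : unitInterval}
    (hab : a ≤ b) :
    X.length f = eVariationOn (fun t => (f t : Plane)) (Set.Icc 0 a) +
      eVariationOn (fun t => (f t : Plane)) (Set.Icc a b) +
      eVariationOn (fun t => (f t : Plane)) (Set.Icc b 1) := by
  have key : ∀ {c d e : unitInterval}, c ≤ d → d ≤ e →
      eVariationOn (fun t => (f t : Plane)) (Set.Icc c d) +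
        eVariationOn (fun t => (f t : Plane)) (Set.Icc d e) =
      eVariationOn (fun t => (f t : Plane)) (Set.Icc c e) := fun h h' => by
    simpa using eVariationOn.Icc_add_Icc (fun t => (f t : Plane)) h h' (Set.mem_univ _)
  rw [key unitInterval.nonneg' hab, key unitInterval.nonneg' unitInterval.le_one', length]
  congr 1
  exact Set.Icc_bot_top.symm

/-- A globally shortest path of finite length runs along the segment between two of its points that
lie in a convex subset of the free space. -/
theorem IsGloballyShortest.mem_of_convex {X : FreeSpace} {x₀ x₁ : X.carrier} {f : Path x₀ x₁}
    (hf : X.IsGloballyShortest f) (hfin : X.length f ≠ ⊤) {C : Set Plane} (hC : Convex ℝ C)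
    (hCX : C ⊆ X.carrier) {a b τ : unitInterval} (haτ : a ≤ τ) (hτb : τ ≤ b)
    (ha : (f a : Plane) ∈ C) (hb : (f b : Plane) ∈ C) : (f τ : Plane) ∈ C := by
  have hab := haτ.trans hτb
  obtain ⟨g, hga, hgb, hg⟩ := X.exists_path_straightened f hC hCX hab ha hb
  have hle := hf g
  rw [length_eq_add X f hab] at hfin
  rw [length_eq_add X f hab, length_eq_add X g hab,
    eVariationOn.eq_of_eqOn (f := fun t => (g t : Plane)) (f' := fun t => (f t : Plane))
      (s := Set.Icc 0 a) (fun t ht => congrArg Subtype.val (hga t ht.2)),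
    eVariationOn.eq_of_eqOn (f := fun t => (g t : Plane)) (f' := fun t => (f t : Plane))
      (s := Set.Icc b 1) (fun t ht => congrArg Subtype.val (hgb t ht.1))] at hle
  simp only [ne_eq, ENNReal.add_eq_top, not_or] at hfin
  rw [ENNReal.add_le_add_iff_right hfin.2, ENNReal.add_le_add_iff_left hfin.1.1] at hle
  have hadd := eVariationOn.Icc_add_Icc (fun t => (f t : Plane)) haτ hτb (Set.mem_univ _)
  simp only [Set.univ_inter] at hadd
  have h1 := eVariationOn.edist_le (fun t => (f t : Plane)) (Set.left_mem_Icc.2 haτ)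
    (Set.right_mem_Icc.2 haτ)
  have h2 := eVariationOn.edist_le (fun t => (f t : Plane)) (Set.left_mem_Icc.2 hτb)
    (Set.right_mem_Icc.2 hτb)
  -- This reverses the triangle inequality; equality means betweenness because the Euclidean norm is
  -- strictly convex.
  have h3 : edist (f a : Plane) (f τ) + edist (f τ : Plane) (f b) ≤ edist (f a : Plane) (f b) :=
    (add_le_add h1 h2).trans (hadd.le.trans (hle.trans hg))
  rw [edist_dist, edist_dist, edist_dist, ← ENNReal.ofReal_add dist_nonneg dist_nonneg,
    ENNReal.ofReal_le_ofReal_iff dist_nonneg] at h3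
  have h4 : Wbtw ℝ (f a : Plane) (f τ) (f b) :=
    dist_add_dist_eq_iff.1 (h3.antisymm (dist_triangle _ _ _))
  exact hC.segment_subset ha hb (mem_segment_iff_wbtw.2 h4)

namespace ConvexDivision

variable {X : FreeSpace}

theorem convex_cell (D : ConvexDivision X) (P : D.cells) : Convex ℝ (P : Set Plane) := by
  obtain ⟨S, -, hS⟩ := D.exists_vertices P P.2
  rw [hS]
  exact convex_convexHull ℝ S

theorem cell_subset_carrier (D : ConvexDivision X) (P : D.cells) : (P : Set Plane) ⊆ X.carrier :=
  D.sUnion_cells ▸ Set.subset_sUnion_of_mem P.2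

/-- The endpoints of a path that runs through a sequence of cells are joined by a path of finite
length. -/
theorem RunsThrough.exists_length_ne_top {D : ConvexDivision X} {x₀ x₁ : X.carrier}
    {f : Path x₀ x₁} {s : List D.cells} (h : D.RunsThrough f s) :
    ∃ g : Path x₀ x₁, X.length g ≠ ⊤ := by
  obtain ⟨-, t, htm, ht0, ht1, hmem⟩ := h
  -- Agreement with `f` from `t k` on keeps the endpoints of the next piece in its cell.
  have key : ∀ k ≤ s.length, ∃ g : Path x₀ x₁, (∀ τ, t k ≤ τ → g τ = f τ) ∧
      eVariationOn (fun τ => (g τ : Plane)) (Set.Icc 0 (t k)) ≠ ⊤ := by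
    intro k
    induction k with
    | zero => exact fun _ => ⟨f, fun _ _ => rfl, by simp [ht0]⟩
    | succ k ih =>
      intro hk
      obtain ⟨g, hgf, hfin⟩ := ih (by omega)
      have hle := htm (Nat.le_succ k)
      have hmem' := hmem k hk
      obtain ⟨g', hga, hgb, hg'⟩ := X.exists_path_straightened g (D.convex_cell s[k])
        (D.cell_subset_carrier s[k]) hle
        (by rw [hgf _ le_rfl]; exact hmem' _ (Set.left_mem_Icc.2 hle))
        (by rw [hgf _ hle]; exact hmem' _ (Set.right_mem_Icc.2 hle))
      refine ⟨g', fun τ hτ => (hgb τ hτ).trans (hgf τ (hle.trans hτ)), ?_⟩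
      have hadd := eVariationOn.Icc_add_Icc (fun τ => (g' τ : Plane))
        (unitInterval.nonneg' : 0 ≤ t k) hle (Set.mem_univ _)
      simp only [Set.univ_inter] at hadd
      rw [← hadd, eVariationOn.eq_of_eqOn (f := fun τ => (g' τ : Plane))
        (f' := fun τ => (g τ : Plane)) (s := Set.Icc 0 (t k))
        (fun τ hτ => congrArg Subtype.val (hga τ hτ.2))]
      exact ENNReal.add_ne_top.2 ⟨hfin, ne_top_of_le_ne_top (edist_ne_top _ _) hg'⟩
  obtain ⟨g, -, hg⟩ := key s.length le_rfl
  refine ⟨g, ?_⟩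
  rw [ht1] at hg
  rwa [length, ← Set.Icc_bot_top]

theorem getElem_take_append_drop {α : Type*} (s : List α) {i j k : ℕ} (hij : i < j)
    (hj : j < s.length) (hk : k < (s.take (i + 1) ++ s.drop (j + 1)).length) :
    (s.take (i + 1) ++ s.drop (j + 1))[k] =
      if h : k ≤ i then s[k]'(by omega)
      else s[k + (j - i)]'(by simp at hk; omega) := by
  grind

/-- If a path that runs through a sequence of cells stays in a repeated cell between its two
occurrences, the cells in between can be dropped together with the second occurrence. -/
theorem RunsThrough.take_append_drop {D : ConvexDivision X} {x₀ x₁ : X.carrier}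
    {f : Path x₀ x₁} {s : List D.cells} (hchain : D.IsTopoPath s) {t : ℕ → unitInterval}
    (htm : Monotone t) (ht0 : t 0 = 0) (ht1 : t s.length = 1)
    (hmem : ∀ (k : ℕ) (hk : k < s.length), ∀ τ ∈ Set.Icc (t k) (t (k + 1)),
      (f τ : Plane) ∈ (s[k] : Set Plane))
    {i j : ℕ} (hij : i < j) (hj : j < s.length) (heq : s[i] = s[j])
    (hstay : ∀ τ ∈ Set.Icc (t (i + 1)) (t j), (f τ : Plane) ∈ (s[i] : Set Plane)) :
    D.RunsThrough f (s.take (i + 1) ++ s.drop (j + 1)) := by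
  have hlen : (s.take (i + 1) ++ s.drop (j + 1)).length = s.length - (j - i) := by
    simp; omega
  refine ⟨⟨List.ne_nil_of_length_pos (by omega), ?_⟩,
    -- The kept copy of the repeated cell now occupies all of `[t i, t (j + 1)]`; later times shift
    -- by `j - i`.
    fun k => if k ≤ i then t k else t (k + (j - i)), ?_, ?_, ?_, ?_⟩
  · have hc := List.isChain_iff_getElem.1 hchain.2
    rw [List.isChain_iff_getElem]
    intro k hk
    rw [getElem_take_append_drop s hij hj, getElem_take_append_drop s hij hj]
    rw [hlen] at hk
    split_ifs with h1 h2 h2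
    · exact hc k (by omega)
    -- At the junction, `s[i] = s[j]` is adjacent to `s[j + 1]`.
    · obtain rfl : k = i := by omega
      have h3 := hc j (by omega)
      simp only [heq]
      convert h3 using 2
      omega
    · omega
    · convert hc (k + (j - i)) (by omega) using 2
      omega
  · intro k l hkl
    dsimp only
    split_ifs <;> exact htm (by omega)
  · simp [ht0]
  · rw [hlen]
    dsimp only
    rw [if_neg (by omega), ← ht1]
    congr 1
    omega
  · intro k hk τ hτ
    rw [getElem_take_append_drop s hij hj]
    rw [hlen] at hk
    dsimp only at hτ
    rcases lt_trichotomy k i with h | rfl | h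
    · rw [if_pos h.le, if_pos (by omega)] at hτ
      rw [dif_pos h.le]
      exact hmem k _ τ hτ
    -- The enlarged interval splits into the first visit, the excursion covered by `hstay`, and the
    -- second visit.
    · rw [if_pos le_rfl, if_neg (by omega), show k + 1 + (j - k) = j + 1 by omega] at hτ
      rw [dif_pos le_rfl]
      rcases le_total τ (t (k + 1)) with h1 | h1
      · exact hmem k _ τ ⟨hτ.1, h1⟩
      rcases le_total τ (t j) with h2 | h2
      · exact hstay τ ⟨h1, h2⟩
      · rw [heq]
        exact hmem j hj τ ⟨h2, hτ.2⟩
    · rw [if_neg (by omega), if_neg (by omega), show k + 1 + (j - i) = k + (j - i) + 1 by omega] at hτ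
      rw [dif_neg (by omega)]
      exact hmem _ _ τ hτ

end ConvexDivision

end FreeSpace

theorem mainTheorem7 (X : FreeSpace) (D : X.ConvexDivision) {x₀ x₁ : X.carrier}
    (f : Path x₀ x₁) (s : List D.cells) (hs : D.IsCellSequence f s)
    (hrep : ¬ s.Nodup) : ¬ X.IsGloballyShortest f := by
  intro hf
  obtain ⟨hrun, hmin⟩ := hs
  obtain ⟨g, hg⟩ := hrun.exists_length_ne_top
  have hfin : X.length f ≠ ⊤ := ne_top_of_le_ne_top hg (hf g)
  obtain ⟨hchain, t, htm, ht0, ht1, hmem⟩ := hrun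
  obtain ⟨i, j, hij, hj, heq⟩ : ∃ i j : ℕ, ∃ (_ : i < j) (_ : j < s.length), s[i] = s[j] := by
    by_contra! hne
    exact hrep (List.pairwise_iff_getElem.2 fun i j _ hj hij => hne i j hij hj)
  -- The straightening is applied between the end `t (i + 1)` of the first visit and the start `t j`
  -- of the second.
  have hrun' := FreeSpace.ConvexDivision.RunsThrough.take_append_drop hchain htm ht0 ht1 hmem
    hij hj heq fun τ hτ => hf.mem_of_convex hfin (D.convex_cell s[i]) (D.cell_subset_carrier s[i])
      hτ.1 hτ.2 (hmem i _ _ (Set.right_mem_Icc.2 (htm (Nat.le_succ i))))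
      (heq ▸ hmem j hj _ (Set.left_mem_Icc.2 (htm (Nat.le_succ j))))
  have hsub : (s.take (i + 1) ++ s.drop (j + 1)).Sublist s := by
    conv_rhs => rw [← List.take_append_drop (i + 1) s]
    exact (List.Sublist.refl _).append (List.drop_sublist_drop_left s (by omega))
  have hlen := congrArg List.length (hmin _ hsub hrun')
  simp at hlen
  omega
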